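/- All Hilbert spaces are complex. Let $H$ be a Hilbert space and let $E\subset B(H)$ be a linear subspace with the operator norm. For $n\ge 0$ the space $M_n(E)$ of $n\times n$ matrices over $E$ carries the norm of $M_n(B(H))=B(H^n)$, where $H^n$ is the Hilbert direct sum. For a linear map $v:E\to F$ between spaces with such matrix norms, $\|v\|_{cb}=\sup_n\|\mathrm{id}_{M_n}\otimes v: M_n(E)\to M_n(F)\|$. A linear bijection $u:E\to F$ is a complete isometry if $[x_{ij}]\mapsto[u(x_{ij})]$ is isometric from $M_n(E)$ to $M_n(F)$ for every $n$. The dual $E^*$ carries the matrix norms $M_n(E^*)=cb(E,M_n)$, a matrix $[f_{ij}]$ being identified with the map $y\mapsto[f_{ij}(y)]$ from $E$ to $M_n=B(\mathbb C^n)$. The conjugate $\overline E$ is $E$ with the scalar multiplication $\lambda\cdot x=\overline\lambda x$; the norm of $[\overline{x_{ij}}]$ in $M_n(\overline E)$ is that of $[x_{ij}]$ in $M_n(E)$, which are the norms given by $\overline E\subset\overline{B(H)}=B(\overline H)$. If $E$ is isometric to $\ell_2(I)$, it has a unique inner product inducing its norm (taken linear in the second variable), and the natural identification $E\to\overline{E^*}$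 is the linear bijection $x\mapsto\overline{\langle x,\cdot\rangle}$. THEOREM. Let $I$ be an arbitrary set. (i) There are a Hilbert space $\mathcal H$ and a subspace $E\subset B(\mathcal H)$ that is isometric to $\ell_2(I)$ and for which the natural identification $E\to\overline{E^*}$ is a complete isometry. (ii) This space is unique up to complete isometry: if $E_1\subset B(\mathcal H_1)$ and $E_2\subset B(\mathcal H_2)$ both have the properties in (i), there is a completely isometric linear bijection $u:E_1\to E_2$. The space is denoted $OH(I)$. (iii) Let $E\subset B(\mathcal H)$ have the properties in (i), let $(T_i)_{i\in I}$ be an orthonormal basis of $E$, and let $(a_i)_{i\in I}$ be a finitely supported family in $B(\ell_2)$, where $\ell_2=\ell_2(\mathbb N)$. Then $$\Big\|\sum_i T_i\otimes a_i\Big\|_{B(\mathcal H\otimes\ell_2)}=\Big\|\sum_i a_i\otimes\overline{a_i}\Big\|_{B(\ell_2\otimes\overline{\ell_2})}^{1/2},$$ where $\otimes$ between Hilbert spaces is the Hilbertian tensor product and $\overline{a}\in B(\overline{\ell_2})$ is the same map as $a$; that is, the norms are those of the minimal tensor products $OH(I)\otimes_{\min}B(\ell_2)$ and $B(\ell_2)\otimes_{\min}B(\overline{\ell_2})$.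 -/

import Mathlib

open scoped TensorProduct ENNReal ComplexConjugate InnerProductSpace

universe u v w

namespace OperatorSpace

noncomputable section

/-! ### Complex conjugate spaces -/

/-- The complex conjugate of a complex vector space: the same additive group, with the
multiplication by scalars `c • x := conj c • x`. -/
def ConjSpace (E : Type*) : Type _ := E

namespace ConjSpace

instance instAddCommGroup (E : Type*) [AddCommGroup E] : AddCommGroup (ConjSpace E) :=
  inferInstanceAs (AddCommGroup E)

instance instNormedAddCommGroup (E : Type*) [NormedAddCommGroup E] :
    NormedAddCommGroup (ConjSpace E) :=
  inferInstanceAs (NormedAddCommGroup E)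

instance instCompleteSpace (E : Type*) [NormedAddCommGroup E] [CompleteSpace E] :
    CompleteSpace (ConjSpace E) :=
  inferInstanceAs (CompleteSpace E)

/-- The identity map, from a space to its conjugate. -/
def mk {E : Type*} [AddCommGroup E] : E ≃+ ConjSpace E := AddEquiv.refl E

instance instModule (E : Type*) [AddCommGroup E] [Module ℂ E] : Module ℂ (ConjSpace E) where
  smul c x := mk (conj c • mk.symm x)
  one_smul x := by
    change conj (1 : ℂ) • (mk.symm x) = mk.symm x
    simp
  mul_smul a b x := by
    change conj (a * b) • (mk.symm x) = conj a • conj b • mk.symm x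
    simp [mul_smul]
  smul_zero a := by
    change conj a • (0 : E) = 0
    simp
  smul_add a x y := by
    change conj a • (mk.symm x + mk.symm y) = conj a • mk.symm x + conj a • mk.symm y
    simp
  add_smul a b x := by
    change conj (a + b) • (mk.symm x) = conj a • mk.symm x + conj b • mk.symm x
    simp [add_smul]
  zero_smul x := by
    change conj (0 : ℂ) • (mk.symm x) = (0 : E)
    simp

theorem smul_mk {E : Type*} [AddCommGroup E] [Module ℂ E] (c : ℂ) (x : E) :
    c • mk x = mk (conj c • x) := rfl

/-- The identity map from a space to its conjugate is conjugate linear. -/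
def mkₗ (E : Type*) [AddCommGroup E] [Module ℂ E] : E ≃ₛₗ[starRingEnd ℂ] ConjSpace E where
  __ := (mk : E ≃+ ConjSpace E)
  map_smul' c x := by
    change mk (c • x) = conj c • mk x
    simp [smul_mk]

instance instNormedSpace (E : Type*) [NormedAddCommGroup E] [NormedSpace ℂ E] :
    NormedSpace ℂ (ConjSpace E) where
  norm_smul_le c x := by
    change ‖conj c • (mk.symm x : E)‖ ≤ ‖c‖ * ‖(mk.symm x : E)‖
    simp [norm_smul]

instance instInnerProductSpace (E : Type*) [NormedAddCommGroup E] [InnerProductSpace ℂ E] :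
    InnerProductSpace ℂ (ConjSpace E) where
  inner x y := inner ℂ (mk.symm y : E) (mk.symm x)
  norm_sq_eq_re_inner x := norm_sq_eq_re_inner (𝕜 := ℂ) (mk.symm x : E)
  conj_inner_symm x y := inner_conj_symm (𝕜 := ℂ) (mk.symm y : E) (mk.symm x)
  add_left x y z := inner_add_right (𝕜 := ℂ) (mk.symm z : E) (mk.symm x) (mk.symm y)
  smul_left x y c := inner_smul_right (𝕜 := ℂ) (mk.symm y : E) (mk.symm x) (conj c)

theorem inner_mk {E : Type*} [NormedAddCommGroup E] [InnerProductSpace ℂ E] (x y : E) :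
    inner ℂ (mk x) (mk y) = inner ℂ y x := rfl

end ConjSpace

/-- The operator `ā` on `H̄`, for an operator `a` on `H`: it is the same map. -/
def conjOp {H : Type*} [NormedAddCommGroup H] [NormedSpace ℂ H] (a : H →L[ℂ] H) :
    ConjSpace H →L[ℂ] ConjSpace H where
  toFun x := ConjSpace.mk (a (ConjSpace.mk.symm x))
  map_add' x y := a.map_add (ConjSpace.mk.symm x) (ConjSpace.mk.symm y)
  map_smul' c x := a.map_smul (conj c) (ConjSpace.mk.symm x)
  cont := a.cont

/-! ### Matrix norms -/

/-- A family of (extended) norms on the square matrices with entries in `E`. The only instances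
used are the concrete ones given below, for which these are the norms of the spaces `Mₙ(E)`. -/
class MatrixNorms (E : Type*) where
  /-- the norm of `Mₙ(E)` -/
  mnorm : ∀ {n : ℕ}, Matrix (Fin n) (Fin n) E → ℝ≥0∞

open MatrixNorms

/-- The operator on the Hilbert direct sum `Hⁿ` given by a matrix of operators on `H`. -/
def matrixOp {H : Type*} [NormedAddCommGroup H] [InnerProductSpace ℂ H] {n : ℕ}
    (x : Matrix (Fin n) (Fin n) (H →L[ℂ] H)) :
    PiLp 2 (fun _ : Fin n => H) →L[ℂ] PiLp 2 (fun _ : Fin n => H) :=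
  (PiLp.continuousLinearEquiv 2 ℂ (fun _ : Fin n => H)).symm.toContinuousLinearMap ∘L
    ContinuousLinearMap.pi fun i => ∑ j, x i j ∘L PiLp.proj 2 (fun _ : Fin n => H) j

theorem matrixOp_apply {H : Type*} [NormedAddCommGroup H] [InnerProductSpace ℂ H] {n : ℕ}
    (x : Matrix (Fin n) (Fin n) (H →L[ℂ] H)) (ξ : PiLp 2 (fun _ : Fin n => H)) (i : Fin n) :
    matrixOp x ξ i = ∑ j, x i j (ξ j) := by
  simp [matrixOp]

/-- `Mₙ(B(H)) = B(Hⁿ)`. -/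
instance instMatrixNormsOp (H : Type*) [NormedAddCommGroup H] [InnerProductSpace ℂ H] :
    MatrixNorms (H →L[ℂ] H) where
  mnorm x := ‖matrixOp x‖ₑ

/-- For a subspace `E` of `B(H)`, `Mₙ(E)` carries the norm of `Mₙ(B(H))`. -/
instance instMatrixNormsSubmodule {H : Type*} [NormedAddCommGroup H] [InnerProductSpace ℂ H]
    (E : Submodule ℂ (H →L[ℂ] H)) : MatrixNorms E where
  mnorm x := mnorm (x.map fun e => (e : H →L[ℂ] H))

/-- The completely bounded norm `sup_n ‖id_{Mₙ} ⊗ v : Mₙ(E) → Mₙ(F)‖` of a linear map `v`. -/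
def cbNorm {E F : Type*} [AddCommGroup E] [Module ℂ E] [AddCommGroup F] [Module ℂ F]
    [MatrixNorms E] [MatrixNorms F] (v : E →ₗ[ℂ] F) : ℝ≥0∞ :=
  ⨆ (m : ℕ) (y : Matrix (Fin m) (Fin m) E) (_ : mnorm y ≤ 1), mnorm (y.map v)

/-- A matrix `f` of functionals on `E`, seen as the linear map `y ↦ [f i j y]` from `E` to
`Mₙ = B(ℂⁿ)`. -/
def matrixOfFunctionals {E : Type*} [NormedAddCommGroup E] [NormedSpace ℂ E] {n : ℕ}
    (f : Matrix (Fin n) (Fin n) (StrongDual ℂ E)) :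
    E →ₗ[ℂ] (EuclideanSpace ℂ (Fin n) →L[ℂ] EuclideanSpace ℂ (Fin n)) where
  toFun y := Matrix.toEuclideanCLM (𝕜 := ℂ) (Matrix.of fun i j => f i j y)
  map_add' y z := by
    rw [← map_add]
    congr 1
    ext i j
    simp
  map_smul' c y := by
    rw [RingHom.id_apply, ← map_smul]
    congr 1
    ext i j
    simp

/-- The operator space dual: `Mₙ(E*) = cb(E, Mₙ)`. -/
instance instMatrixNormsDual (E : Type*) [NormedAddCommGroup E] [NormedSpace ℂ E]
    [MatrixNorms E] : MatrixNorms (StrongDual ℂ E) where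
  mnorm f := cbNorm (matrixOfFunctionals f)

/-- The conjugate operator space: a matrix `[x̄ i j]` has the norm of `[x i j]` (for `E ⊂ B(H)`
these are the norms given by the inclusion `Ē ⊂ B(H̄)`, `x̄ = conjOp x`). -/
instance instMatrixNormsConj (E : Type*) [AddCommGroup E] [MatrixNorms E] :
    MatrixNorms (ConjSpace E) where
  mnorm x := mnorm (x.map (ConjSpace.mk.symm : ConjSpace E → E))

/-- On matrices over `B(H)`, the norms of the conjugate operator space are those of `B(H̄)`. -/
theorem mnorm_conjOp {H : Type*} [NormedAddCommGroup H] [InnerProductSpace ℂ H] {n : ℕ}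
    (x : Matrix (Fin n) (Fin n) (H →L[ℂ] H)) : mnorm (x.map conjOp) = mnorm x := by
  let c : PiLp 2 (fun _ : Fin n => H) → PiLp 2 (fun _ : Fin n => ConjSpace H) :=
    fun ξ => WithLp.toLp 2 fun i => ConjSpace.mk (ξ i)
  have hc : ∀ η, ∃ ξ, c ξ = η := fun η =>
    ⟨WithLp.toLp 2 fun i => ConjSpace.mk.symm (η i), rfl⟩
  have key : ∀ ξ, matrixOp (x.map conjOp) (c ξ) = c (matrixOp x ξ) := by
    intro ξ
    apply PiLp.ext
    intro i
    have h : c (matrixOp x ξ) i = ConjSpace.mk (matrixOp x ξ i) := rfl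
    rw [h, matrixOp_apply, matrixOp_apply, map_sum]
    rfl
  have nrm : ∀ ξ, ‖c ξ‖ = ‖ξ‖ := by
    intro ξ
    rw [PiLp.norm_eq_of_L2, PiLp.norm_eq_of_L2]
    rfl
  have main : ‖matrixOp (x.map conjOp)‖ = ‖matrixOp x‖ := by
    apply le_antisymm
    · refine ContinuousLinearMap.opNorm_le_bound _ (ContinuousLinearMap.opNorm_nonneg _) fun η => ?_
      obtain ⟨ξ, rfl⟩ := hc η
      rw [key, nrm, nrm]
      exact (matrixOp x).le_opNorm ξ
    · refine ContinuousLinearMap.opNorm_le_bound _ (ContinuousLinearMap.opNorm_nonneg _) fun ξ => ?_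
      rw [← nrm, ← nrm ξ, ← key]
      exact (matrixOp (x.map conjOp)).le_opNorm (c ξ)
  have h₁ : mnorm (x.map conjOp) = ENNReal.ofReal ‖matrixOp (x.map conjOp)‖ :=
    (ofReal_norm _).symm
  have h₂ : mnorm x = ENNReal.ofReal ‖matrixOp x‖ := (ofReal_norm _).symm
  rw [h₁, h₂, main]

/-- A linear bijection `u : E → F` is a complete isometry if, for every `n`, the map
`[x i j] ↦ [u (x i j)]` from `Mₙ(E)` to `Mₙ(F)` is isometric. -/
def IsCompleteIsometry {E F : Type*} [AddCommGroup E] [Module ℂ E] [AddCommGroup F] [Module ℂ F]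
    [MatrixNorms E] [MatrixNorms F] (u : E ≃ₗ[ℂ] F) : Prop :=
  ∀ (n : ℕ) (x : Matrix (Fin n) (Fin n) E), mnorm (x.map u) = mnorm x

/-! ### Hilbertian operator spaces and the antidual -/

/-- The Hilbert space `ℓ₂(I)`. -/
abbrev Ell2 (I : Type*) : Type _ := lp (fun _ : I => ℂ) 2

/-- The natural identification of a space `E`, isometric to `ℓ₂(I)`, with its antidual:
`x` goes to the functional `⟨x, ·⟩` (linear in the second variable), the inner product of `E`
being that of `ℓ₂(I)`. -/
def toAntidual {I E : Type*} [NormedAddCommGroup E] [NormedSpace ℂ E]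
    (U : E ≃ₗᵢ[ℂ] Ell2 I) : E ≃ₗ[ℂ] ConjSpace (StrongDual ℂ E) :=
  ((U.toLinearEquiv.trans (InnerProductSpace.toDual ℂ (Ell2 I)).toLinearEquiv).trans
    (U.toContinuousLinearEquiv.arrowCongr (ContinuousLinearEquiv.refl ℂ ℂ)).symm.toLinearEquiv).trans
    (ConjSpace.mkₗ (StrongDual ℂ E))

theorem toAntidual_apply {I E : Type*} [NormedAddCommGroup E] [NormedSpace ℂ E]
    (U : E ≃ₗᵢ[ℂ] Ell2 I) (x y : E) :
    (ConjSpace.mk.symm (toAntidual U x) : StrongDual ℂ E) y = inner ℂ (U x) (U y) := rfl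

/-- The natural identification does not depend on the isometry chosen between `E` and `ℓ₂(I)`. -/
theorem toAntidual_eq {I J E : Type*} [NormedAddCommGroup E] [NormedSpace ℂ E]
    (U : E ≃ₗᵢ[ℂ] Ell2 I) (V : E ≃ₗᵢ[ℂ] Ell2 J) : toAntidual U = toAntidual V := by
  ext x
  apply ConjSpace.mk.symm.injective
  ext y
  rw [toAntidual_apply, toAntidual_apply]
  have h := (U.symm.trans V).inner_map_map (U x) (U y)
  simpa using h.symm

/-- A subspace `E` of `B(H)` is isometric to `ℓ₂(I)`, and its natural identification with its
antidual is a complete isometry. -/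
def IsOH (I : Type*) {H : Type*} [NormedAddCommGroup H] [InnerProductSpace ℂ H]
    (E : Submodule ℂ (H →L[ℂ] H)) : Prop :=
  ∃ U : E ≃ₗᵢ[ℂ] Ell2 I, IsCompleteIsometry (toAntidual U)

/-- `T` is an orthonormal basis, indexed by `I`, of a space `E` isometric to `ℓ₂(I)`: an isometry
carries it to an orthonormal basis of `ℓ₂(I)`. -/
def IsHilbertBasis {I E : Type*} [NormedAddCommGroup E] [NormedSpace ℂ E] (T : I → E) : Prop :=
  ∃ (U : E ≃ₗᵢ[ℂ] Ell2 I) (b : HilbertBasis I ℂ (Ell2 I)), ∀ i, U (T i) = b i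

/-! ### Tensor products of operators -/

/-- The Hilbertian tensor product. -/
abbrev HilbertTensor (H K : Type*) [NormedAddCommGroup H] [InnerProductSpace ℂ H]
    [NormedAddCommGroup K] [InnerProductSpace ℂ K] : Type _ :=
  UniformSpace.Completion (H ⊗[ℂ] K)

/-- The operator `a ⊗ b` on the Hilbertian tensor product; the norm of the minimal tensor product
of `E ⊂ B(H)` and `F ⊂ B(K)` is the operator norm on the span of these. -/
def tensorOp {H K : Type*} [NormedAddCommGroup H] [InnerProductSpace ℂ H]
    [NormedAddCommGroup K] [InnerProductSpace ℂ K] (a : H →L[ℂ] H) (b : K →L[ℂ] K) :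
    HilbertTensor H K →L[ℂ] HilbertTensor H K :=
  (TensorProduct.mapL a b).completion

theorem tensorOp_tmul {H K : Type*} [NormedAddCommGroup H] [InnerProductSpace ℂ H]
    [NormedAddCommGroup K] [InnerProductSpace ℂ K] (a : H →L[ℂ] H) (b : K →L[ℂ] K)
    (x : H) (y : K) :
    tensorOp a b ((x ⊗ₜ[ℂ] y : H ⊗[ℂ] K) : HilbertTensor H K) =
      ((a x ⊗ₜ[ℂ] b y : H ⊗[ℂ] K) : HilbertTensor H K) := by
  simp [tensorOp]

end

end OperatorSpace

/-!
A matrix `x` over a Hilbert space `K` and a matrix `y` over `K` have a pairing, the scalar matrix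
`[⟨x i j, y k l⟩]`, whose operator norm is written here as `‖pairingOp x y‖`. The theorem rests on
Haagerup's Cauchy–Schwarz inequality `‖pairingOp x y‖ ≤ ‖pairingOp x x‖^{1/2} ‖pairingOp y y‖^{1/2}`
(`norm_pairingOp_le`), which is proved by writing both vectors in a matrix coefficient of
`pairingOp x y` as sums of elementary tensors `∑ σ_s p̄_s ⊗ e_s` with orthonormal `p` and `e`
(singular values), and applying the usual Cauchy–Schwarz inequality with the weights `σ_s τ_t`.

Consequently a space `E ⊂ B(H)` isometric to `ℓ₂(I)` is completely isometric to its antidual if and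
only if the norm of every matrix `x` over `E` is `‖pairingOp x x‖^{1/2}` (`isOH_iff`). The norms of
the matrices over `E` are then determined by the inner product, so any linear isometry between two
such spaces is a complete isometry: this is uniqueness. For existence, `K = ℓ₂(I)` acts
on the Hilbert direct sum of spaces `ℂᵐ`, over all `y` in `Mₘ(K)` with `‖pairingOp y y‖ ≤ 1`, by the
blocks `[⟨y k l, z⟩]`; Haagerup's inequality says that this gives the norms
`‖pairingOp x x‖^{1/2}` (`norm_matrixOp_ohMap`).

For the norm of `∑ T i ⊗ a i`, let `e` be the standard basis of `ℓ₂`. Compressing every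
`a i` to the span of the first `n` vectors of `e` turns `∑ T i ⊗ a i` into the matrix
`x n = [∑ ⟨e k, a i (e l)⟩ T i]` over `E`, and `∑ a i ⊗ ā i` into `pairingOp (x n) (x n)`. The norm
of an operator is the supremum of the norms of these compressions, and `isOH_iff` compares them for
each `n`.
-/

namespace OperatorSpace

noncomputable section

set_option maxSynthPendingDepth 3

open MatrixNorms

/-! ### Operator norms through matrix coefficients -/

theorem opNorm_le_of_norm_inner_le_of_dense {V : Type*} [NormedAddCommGroup V]
    [InnerProductSpace ℂ V] {D : Set V} (hD : Dense D) (X : V →L[ℂ] V) {C : ℝ} (hC : 0 ≤ C)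
    (h : ∀ u ∈ D, ∀ v ∈ D, ‖⟪u, X v⟫_ℂ‖ ≤ C * ‖u‖ * ‖v‖) : ‖X‖ ≤ C := by
  have hcl : IsClosed {p : V × V | ‖⟪p.1, X p.2⟫_ℂ‖ ≤ C * ‖p.1‖ * ‖p.2‖} :=
    isClosed_le (by fun_prop) (by fun_prop)
  have hall : ∀ u v, ‖⟪u, X v⟫_ℂ‖ ≤ C * ‖u‖ * ‖v‖ := by
    intro u v
    have : (u, v) ∈ closure (D ×ˢ D) := by
      rw [closure_prod_eq]
      exact ⟨hD u, hD v⟩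
    exact closure_minimal (fun p hp => h p.1 hp.1 p.2 hp.2) hcl this
  refine X.opNorm_le_bound hC fun v => ?_
  have h1 := hall (X v) v
  rw [inner_self_eq_norm_sq_to_K, norm_pow, RCLike.norm_ofReal, abs_norm] at h1
  rcases eq_or_ne ‖X v‖ 0 with h0 | h0
  · rw [h0]; positivity
  · have hpos : 0 < ‖X v‖ := lt_of_le_of_ne (norm_nonneg _) h0.symm
    nlinarith

theorem opNorm_le_of_norm_inner_le {V : Type*} [NormedAddCommGroup V] [InnerProductSpace ℂ V]
    (X : V →L[ℂ] V) {C : ℝ} (hC : 0 ≤ C) (h : ∀ u v, ‖⟪u, X v⟫_ℂ‖ ≤ C * ‖u‖ * ‖v‖) :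
    ‖X‖ ≤ C :=
  opNorm_le_of_norm_inner_le_of_dense dense_univ X hC fun u _ v _ => h u v

theorem norm_inner_apply_le {V : Type*} [NormedAddCommGroup V] [InnerProductSpace ℂ V]
    (X : V →L[ℂ] V) (u v : V) : ‖⟪u, X v⟫_ℂ‖ ≤ ‖X‖ * ‖u‖ * ‖v‖ := by
  calc ‖⟪u, X v⟫_ℂ‖ ≤ ‖u‖ * ‖X v‖ := norm_inner_le_norm _ _
    _ ≤ ‖u‖ * (‖X‖ * ‖v‖) := by gcongr; exact X.le_opNorm v
    _ = ‖X‖ * ‖u‖ * ‖v‖ := by ring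

theorem matrixOp_smul {H : Type*} [NormedAddCommGroup H] [InnerProductSpace ℂ H] {n : ℕ}
    (c : ℂ) (x : Matrix (Fin n) (Fin n) (H →L[ℂ] H)) : matrixOp (c • x) = c • matrixOp x := by
  ext ξ i
  simp [matrixOp_apply, Finset.smul_sum]

/-! ### Singular value decomposition -/

/-- The terms with singular value zero are left out, which makes `e` orthonormal. -/
theorem exists_singularValueDecomposition {E F : Type*} [NormedAddCommGroup E]
    [InnerProductSpace ℂ E] [FiniteDimensional ℂ E] [NormedAddCommGroup F] [InnerProductSpace ℂ F]
    [FiniteDimensional ℂ F] (A : E →ₗ[ℂ] F) :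
    ∃ (S : Type) (_ : Fintype S) (σ : S → ℝ) (p : S → E) (e : S → F), (∀ s, 0 ≤ σ s) ∧
      Orthonormal ℂ p ∧ Orthonormal ℂ e ∧ ∀ w, A w = ∑ s, ((σ s : ℂ) * ⟪p s, w⟫_ℂ) • e s := by
  classical
  have hS : (LinearMap.adjoint A ∘ₗ A).IsSymmetric := fun u v => by
    simp [LinearMap.adjoint_inner_left, LinearMap.adjoint_inner_right]
  let b := hS.eigenvectorBasis (n := Module.finrank ℂ E) rfl
  -- the images under `A` of an eigenbasis of `A* A` are orthogonal
  have horth : ∀ i j, i ≠ j → ⟪A (b i), A (b j)⟫_ℂ = 0 := by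
    intro i j hij
    have h := hS.apply_eigenvectorBasis (n := Module.finrank ℂ E) rfl j
    rw [← LinearMap.adjoint_inner_right, ← LinearMap.comp_apply, h, inner_smul_right,
      (hS.eigenvectorBasis rfl).orthonormal.2 hij, mul_zero]
  let S := {i : Fin (Module.finrank ℂ E) // A (b i) ≠ 0}
  refine ⟨S, inferInstance, fun s => ‖A (b s)‖, fun s => b s,
    fun s => ((‖A (b s)‖⁻¹ : ℝ) : ℂ) • A (b s), fun s => norm_nonneg _,
    b.orthonormal.comp _ Subtype.val_injective, ⟨fun s => ?_, fun s t hst => ?_⟩, fun w => ?_⟩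
  · rw [norm_smul, Complex.norm_real, norm_inv, norm_norm,
      inv_mul_cancel₀ (norm_ne_zero_iff.2 s.2)]
  · simp [inner_smul_left, inner_smul_right, horth s t fun h => hst (Subtype.ext h)]
  · have h1 : ∀ s : S, ((‖A (b s)‖ : ℂ) * ⟪b s, w⟫_ℂ) • (((‖A (b s)‖⁻¹ : ℝ) : ℂ) • A (b s)) =
        ⟪b s, w⟫_ℂ • A (b s) := by
      intro s
      have : (‖A (b s)‖ : ℂ) ≠ 0 := by exact_mod_cast norm_ne_zero_iff.2 s.2
      rw [smul_smul]
      congr 1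
      push_cast
      field_simp
    rw [Finset.sum_congr rfl fun s _ => h1 s]
    conv_lhs => rw [← b.sum_repr' w, map_sum]
    simp only [map_smul]
    rw [← Finset.sum_subtype (Finset.univ.filter fun i => A (b i) ≠ 0) (by simp)
      fun i => ⟪b i, w⟫_ℂ • A (b i)]
    refine (Finset.sum_filter_of_ne (p := fun i => A (b i) ≠ 0) fun i _ h h0 => h ?_).symm
    rw [h0, smul_zero]

/-! ### The sesquilinear pairing of matrices over a Hilbert space -/

section Pairing

variable {K : Type*} [NormedAddCommGroup K] [InnerProductSpace ℂ K] {n m : ℕ}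

/-- For matrices `x`, `y` over a Hilbert space, the operator `[⟨x i j, y k l⟩]` on
`(ℂⁿ)ᵐ`: the indices `k`, `l` are those of the outer matrix, with entries in `Mₙ = B(ℂⁿ)`. -/
def pairingOp (x : Matrix (Fin n) (Fin n) K) (y : Matrix (Fin m) (Fin m) K) :
    PiLp 2 (fun _ : Fin m => EuclideanSpace ℂ (Fin n)) →L[ℂ]
      PiLp 2 (fun _ : Fin m => EuclideanSpace ℂ (Fin n)) :=
  matrixOp (Matrix.of fun k l =>
    Matrix.toEuclideanCLM (𝕜 := ℂ) (Matrix.of fun i j => ⟪x i j, y k l⟫_ℂ))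

theorem pairingOp_apply (x : Matrix (Fin n) (Fin n) K) (y : Matrix (Fin m) (Fin m) K)
    (v : PiLp 2 (fun _ : Fin m => EuclideanSpace ℂ (Fin n))) (k : Fin m) (i : Fin n) :
    pairingOp x y v k i = ∑ l, ∑ j, ⟪x i j, y k l⟫_ℂ * v l j := by
  rw [pairingOp, matrixOp_apply, WithLp.ofLp_sum, Finset.sum_apply]
  rfl

theorem inner_pairingOp (x : Matrix (Fin n) (Fin n) K) (y : Matrix (Fin m) (Fin m) K)
    (u v : PiLp 2 (fun _ : Fin m => EuclideanSpace ℂ (Fin n))) :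
    ⟪u, pairingOp x y v⟫_ℂ =
      ∑ k, ∑ i, ∑ l, ∑ j, conj (u k i) * (⟪x i j, y k l⟫_ℂ * v l j) := by
  simp only [PiLp.inner_apply, pairingOp_apply, RCLike.inner_apply, Finset.sum_mul]
  refine Finset.sum_congr rfl fun k _ => Finset.sum_congr rfl fun i _ =>
    Finset.sum_congr rfl fun l _ => Finset.sum_congr rfl fun j _ => mul_comm _ _

theorem pairingOp_smul_right (x : Matrix (Fin n) (Fin n) K) (y : Matrix (Fin m) (Fin m) K)
    (c : ℂ) : pairingOp x (c • y) = c • pairingOp x y := by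
  ext v k i
  simp [pairingOp_apply, Finset.mul_sum, mul_assoc]

theorem pairingOp_smul_left (x : Matrix (Fin n) (Fin n) K) (y : Matrix (Fin m) (Fin m) K)
    (c : ℂ) : pairingOp (c • x) y = conj c • pairingOp x y := by
  ext v k i
  simp [pairingOp_apply, Finset.mul_sum, mul_left_comm, mul_assoc]

/-- The element `p̄ ⊗ e` of `ℂᵐ ⊗ ℂⁿ = (ℂⁿ)ᵐ`. -/
def elemTensor (p : EuclideanSpace ℂ (Fin m)) (e : EuclideanSpace ℂ (Fin n)) :
    PiLp 2 (fun _ : Fin m => EuclideanSpace ℂ (Fin n)) :=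
  WithLp.toLp 2 fun k => conj (p k) • e

theorem inner_elemTensor (p q : EuclideanSpace ℂ (Fin m)) (e g : EuclideanSpace ℂ (Fin n)) :
    ⟪elemTensor p e, elemTensor q g⟫_ℂ = ⟪q, p⟫_ℂ * ⟪e, g⟫_ℂ := by
  have h : ∀ k, ⟪elemTensor p e k, elemTensor q g k⟫_ℂ = p k * conj (q k) * ⟪e, g⟫_ℂ := fun k => by
    rw [elemTensor, elemTensor, inner_smul_left, inner_smul_right, Complex.conj_conj, mul_assoc]
  rw [PiLp.inner_apply, PiLp.inner_apply, Finset.sum_mul]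
  exact Finset.sum_congr rfl fun k _ => h k

theorem norm_sq_sum_smul_elemTensor {S : Type*} [Fintype S] (σ : S → ℝ)
    {p : S → EuclideanSpace ℂ (Fin m)} {e : S → EuclideanSpace ℂ (Fin n)}
    (hp : Orthonormal ℂ p) (he : Orthonormal ℂ e) :
    ‖∑ s, (σ s : ℂ) • elemTensor (p s) (e s)‖ ^ 2 = ∑ s, σ s ^ 2 := by
  classical
  have ho : Orthonormal ℂ fun s => elemTensor (p s) (e s) := by
    rw [orthonormal_iff_ite] at hp he ⊢
    intro s t
    rw [inner_elemTensor, hp, he]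
    by_cases h : s = t
    · simp [h]
    · simp [h, Ne.symm h]
  have h := inner_self_eq_norm_sq_to_K (𝕜 := ℂ) (∑ s, (σ s : ℂ) • elemTensor (p s) (e s))
  rw [ho.inner_sum] at h
  have h' : ((∑ s, σ s ^ 2 : ℝ) : ℂ) =
      ((‖∑ s, (σ s : ℂ) • elemTensor (p s) (e s)‖ ^ 2 : ℝ) : ℂ) := by
    push_cast
    refine Eq.trans ?_ h
    refine Finset.sum_congr rfl fun s _ => ?_
    rw [Complex.conj_ofReal, sq]
  exact_mod_cast h'.symm

/-- The Schmidt decomposition of a vector `u` of `ℂᵐ ⊗ ℂⁿ`, from the singular value decomposition of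
the map `w ↦ ∑ w k • u k`. -/
theorem exists_eq_sum_smul_elemTensor (u : PiLp 2 (fun _ : Fin m => EuclideanSpace ℂ (Fin n))) :
    ∃ (S : Type) (_ : Fintype S) (σ : S → ℝ) (p : S → EuclideanSpace ℂ (Fin m))
      (e : S → EuclideanSpace ℂ (Fin n)), (∀ s, 0 ≤ σ s) ∧ Orthonormal ℂ p ∧ Orthonormal ℂ e ∧
      u = ∑ s, (σ s : ℂ) • elemTensor (p s) (e s) := by
  let A : EuclideanSpace ℂ (Fin m) →ₗ[ℂ] EuclideanSpace ℂ (Fin n) :=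
    { toFun := fun w => ∑ k, w k • u k
      map_add' := fun w z => by simp [add_smul, Finset.sum_add_distrib]
      map_smul' := fun c w => by simp [mul_smul, Finset.smul_sum] }
  obtain ⟨S, _, σ, p, e, hσ, hp, he, hA⟩ := exists_singularValueDecomposition A
  refine ⟨S, inferInstance, σ, p, e, hσ, hp, he, ?_⟩
  apply PiLp.ext
  intro k
  have h1 : A (EuclideanSpace.single k 1) = u k := by
    change ∑ l, (EuclideanSpace.single k (1 : ℂ) : EuclideanSpace ℂ (Fin m)) l • u l = u k
    rw [Finset.sum_eq_single k] <;> simp +contextual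
  rw [← h1, hA, WithLp.ofLp_sum, Finset.sum_apply]
  refine Finset.sum_congr rfl fun s _ => ?_
  rw [EuclideanSpace.inner_single_right, one_mul, mul_smul]
  rfl

/-- The vector `∑ p i conj(q j) x i j`, that is `⟨p̄, x q̄⟩` for the matrix `x`. -/
def sandwich (p q : EuclideanSpace ℂ (Fin n)) (x : Matrix (Fin n) (Fin n) K) : K :=
  ∑ i, ∑ j, (p i * conj (q j)) • x i j

/-- This is what separates `x` from `y` in the pairing: its value at elementary tensors is an inner
product of two vectors, of which one depends on `x` only and the other on `y` only. -/
theorem inner_elemTensor_pairingOp (x : Matrix (Fin n) (Fin n) K) (y : Matrix (Fin m) (Fin m) K)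
    (p q : EuclideanSpace ℂ (Fin m)) (e g : EuclideanSpace ℂ (Fin n)) :
    ⟪elemTensor p e, pairingOp x y (elemTensor q g)⟫_ℂ =
      ⟪sandwich e g x, sandwich p q y⟫_ℂ := by
  rw [inner_pairingOp]
  simp only [sandwich, sum_inner, inner_sum, inner_smul_left, inner_smul_right, elemTensor,
    PiLp.smul_apply, smul_eq_mul, map_mul, Complex.conj_conj]
  refine Finset.sum_congr rfl fun k _ => ?_
  rw [Finset.sum_comm]
  refine Finset.sum_congr rfl fun l _ => ?_
  rw [Finset.mul_sum]
  refine Finset.sum_congr rfl fun i _ => ?_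
  rw [Finset.mul_sum]
  refine Finset.sum_congr rfl fun j _ => ?_
  ring

theorem inner_sum_elemTensor_pairingOp (x : Matrix (Fin n) (Fin n) K)
    (y : Matrix (Fin m) (Fin m) K) {S R : Type*} [Fintype S] [Fintype R] (σ : S → ℝ) (τ : R → ℝ)
    (p : S → EuclideanSpace ℂ (Fin m)) (q : R → EuclideanSpace ℂ (Fin m))
    (e : S → EuclideanSpace ℂ (Fin n)) (g : R → EuclideanSpace ℂ (Fin n)) :
    ⟪∑ s, (σ s : ℂ) • elemTensor (p s) (e s),
        pairingOp x y (∑ t, (τ t : ℂ) • elemTensor (q t) (g t))⟫_ℂ =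
      ∑ s, ∑ t, ((σ s * τ t : ℝ) : ℂ) *
        ⟪sandwich (e s) (g t) x, sandwich (p s) (q t) y⟫_ℂ := by
  simp only [map_sum, map_smul, sum_inner, inner_sum, inner_smul_left, inner_smul_right,
    inner_elemTensor_pairingOp, Complex.conj_ofReal]
  simp only [Finset.mul_sum]
  rw [Finset.sum_comm]
  refine Finset.sum_congr rfl fun s _ => Finset.sum_congr rfl fun t _ => ?_
  push_cast
  ring

/-- The diagonal case `y = x`: a weighted sum of the squared norms of the vectors
`sandwich (e s) (g t) x` is a matrix coefficient of `pairingOp x x`, at vectors of norms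
`(∑ σ²)^{1/2}` and `(∑ τ²)^{1/2}`. -/
theorem sum_mul_norm_sandwich_sq_le (x : Matrix (Fin n) (Fin n) K) {S R : Type*} [Fintype S]
    [Fintype R] (σ : S → ℝ) (τ : R → ℝ) {e : S → EuclideanSpace ℂ (Fin n)}
    {g : R → EuclideanSpace ℂ (Fin n)} (he : Orthonormal ℂ e) (hg : Orthonormal ℂ g) :
    ∑ s, ∑ t, σ s * τ t * ‖sandwich (e s) (g t) x‖ ^ 2 ≤
      ‖pairingOp x x‖ * √(∑ s, σ s ^ 2) * √(∑ t, τ t ^ 2) := by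
  rw [← norm_sq_sum_smul_elemTensor σ he he, ← norm_sq_sum_smul_elemTensor τ hg hg,
    Real.sqrt_sq (norm_nonneg _), Real.sqrt_sq (norm_nonneg _)]
  refine le_trans ?_ (norm_inner_apply_le _ _ _)
  rw [inner_sum_elemTensor_pairingOp]
  refine le_trans (le_of_eq ?_) (Complex.re_le_norm _)
  simp only [inner_self_eq_norm_sq_to_K, Complex.re_sum]
  refine Finset.sum_congr rfl fun s _ => Finset.sum_congr rfl fun t _ => ?_
  rw [Complex.re_ofReal_mul]
  norm_cast

/-- The Cauchy–Schwarz inequality of Haagerup. Both vectors in a matrix coefficient of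
`pairingOp x y` are replaced by their Schmidt decompositions; the usual Cauchy–Schwarz inequality
then gives matrix coefficients of `pairingOp x x` and of `pairingOp y y`. -/
theorem norm_pairingOp_le (x : Matrix (Fin n) (Fin n) K) (y : Matrix (Fin m) (Fin m) K) :
    ‖pairingOp x y‖ ≤ √‖pairingOp x x‖ * √‖pairingOp y y‖ := by
  refine opNorm_le_of_norm_inner_le _ (by positivity) fun u v => ?_
  obtain ⟨S, _, σ, p, e, hσ, hp, he, rfl⟩ := exists_eq_sum_smul_elemTensor u
  obtain ⟨R, _, τ, q, g, hτ, hq, hg, rfl⟩ := exists_eq_sum_smul_elemTensor v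
  have hu : ‖∑ s, (σ s : ℂ) • elemTensor (p s) (e s)‖ = √(∑ s, σ s ^ 2) := by
    rw [← norm_sq_sum_smul_elemTensor σ hp he, Real.sqrt_sq (norm_nonneg _)]
  have hv : ‖∑ t, (τ t : ℂ) • elemTensor (q t) (g t)‖ = √(∑ t, τ t ^ 2) := by
    rw [← norm_sq_sum_smul_elemTensor τ hq hg, Real.sqrt_sq (norm_nonneg _)]
  rw [hu, hv, inner_sum_elemTensor_pairingOp, ← Fintype.sum_prod_type']
  set a := √(∑ s, σ s ^ 2)
  set b := √(∑ t, τ t ^ 2)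
  have hx := sum_mul_norm_sandwich_sq_le x σ τ he hg
  have hy := sum_mul_norm_sandwich_sq_le y σ τ hp hq
  rw [← Fintype.sum_prod_type'] at hx hy
  have hw : ∀ st : S × R, 0 ≤ σ st.1 * τ st.2 := fun st => mul_nonneg (hσ _) (hτ _)
  have hcs : (∑ st : S × R, σ st.1 * τ st.2 *
      (‖sandwich (e st.1) (g st.2) x‖ * ‖sandwich (p st.1) (q st.2) y‖)) ^ 2 ≤
      (∑ st : S × R, σ st.1 * τ st.2 * ‖sandwich (e st.1) (g st.2) x‖ ^ 2) *
        ∑ st : S × R, σ st.1 * τ st.2 * ‖sandwich (p st.1) (q st.2) y‖ ^ 2 := by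
    refine Finset.sum_sq_le_sum_mul_sum_of_sq_le_mul _
      (fun st _ => mul_nonneg (hw st) (sq_nonneg _))
      (fun st _ => mul_nonneg (hw st) (sq_nonneg _)) fun st _ => le_of_eq ?_
    ring
  calc _ ≤ ∑ st : S × R, σ st.1 * τ st.2 *
      (‖sandwich (e st.1) (g st.2) x‖ * ‖sandwich (p st.1) (q st.2) y‖) := by
        refine (norm_sum_le _ _).trans (Finset.sum_le_sum fun st _ => ?_)
        rw [norm_mul, Complex.norm_real, Real.norm_of_nonneg (hw st)]
        exact mul_le_mul_of_nonneg_left (norm_inner_le_norm _ _) (hw st)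
    _ ≤ √((‖pairingOp x x‖ * a * b) * (‖pairingOp y y‖ * a * b)) := by
        refine Real.le_sqrt_of_sq_le (hcs.trans (mul_le_mul hx hy ?_ (by positivity)))
        exact Finset.sum_nonneg fun st _ => mul_nonneg (hw st) (sq_nonneg _)
    _ = √‖pairingOp x x‖ * √‖pairingOp y y‖ * a * b := by
        rw [show (‖pairingOp x x‖ * a * b) * (‖pairingOp y y‖ * a * b) =
          ‖pairingOp x x‖ * ‖pairingOp y y‖ * (a * b) ^ 2 by ring, Real.sqrt_mul (by positivity),
          Real.sqrt_sq (by positivity), Real.sqrt_mul (norm_nonneg _)]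
        ring

end Pairing

/-! ### Self-dual Hilbertian operator spaces -/

/-- The natural identification of `E` with its antidual is completely isometric exactly when
the norm of every matrix `x` over `E` is `‖[⟨x i j, x k l⟩]‖^{1/2}`. In one direction, that norm is
self-dual by Haagerup's inequality, the supremum being attained at a multiple of `x`. In the other,
self-duality gives `‖[⟨x i j, x k l⟩]‖ ≤ ‖x‖²`, which bounds the factor of `y` in Haagerup's
inequality for `[⟨x i j, y k l⟩]`. The matrix norms of `E` are real numbers here, denoted `N`. -/
theorem isCompleteIsometry_toAntidual_iff {I E : Type*} [NormedAddCommGroup E]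
    [NormedSpace ℂ E] [MatrixNorms E] (N : ∀ {n : ℕ}, Matrix (Fin n) (Fin n) E → ℝ)
    (hN0 : ∀ {n : ℕ} (x : Matrix (Fin n) (Fin n) E), 0 ≤ N x)
    (hNsmul : ∀ {n : ℕ} (c : ℂ) (x : Matrix (Fin n) (Fin n) E), N (c • x) = ‖c‖ * N x)
    (hmn : ∀ {n : ℕ} (x : Matrix (Fin n) (Fin n) E), mnorm x = ENNReal.ofReal (N x))
    (U : E ≃ₗᵢ[ℂ] Ell2 I) :
    IsCompleteIsometry (toAntidual U) ↔ ∀ (n : ℕ) (x : Matrix (Fin n) (Fin n) E),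
      N x = √‖pairingOp (x.map U) (x.map U)‖ := by
  have hUsmul : ∀ {n : ℕ} (c : ℂ) (x : Matrix (Fin n) (Fin n) E),
      (c • x).map U = c • x.map U := by
    intro n c x
    ext i j : 2
    simp
  have hdual : ∀ {n : ℕ} (x : Matrix (Fin n) (Fin n) E), mnorm (x.map (toAntidual U)) =
      ⨆ (m : ℕ) (y : Matrix (Fin m) (Fin m) E) (_ : ENNReal.ofReal (N y) ≤ 1),
        ENNReal.ofReal ‖pairingOp (x.map U) (y.map U)‖ := by
    intro n x
    simp only [← hmn, ofReal_norm]
    rfl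
  constructor
  · intro h n x
    have hle : ∀ {m : ℕ} (y : Matrix (Fin m) (Fin m) E),
        ‖pairingOp (y.map U) (y.map U)‖ ≤ N y ^ 2 := by
      intro m y
      have key : ∀ z : Matrix (Fin m) (Fin m) E, N z ≤ 1 →
          ‖pairingOp (y.map U) (z.map U)‖ ≤ N y := by
        intro z hz
        have h1 := h m y
        rw [hdual, hmn] at h1
        rw [← ENNReal.ofReal_le_ofReal_iff (hN0 y), ← h1]
        exact le_iSup_of_le m (le_iSup_of_le z (le_iSup_of_le (by simpa using hz) le_rfl))
      rcases (hN0 y).eq_or_lt with h0 | h0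
      · have := key y (by linarith)
        rw [← h0] at this ⊢
        simpa using this
      · -- the pairing of `y` with the matrix `y / N y`, of norm one
        have h1 := key ((((N y)⁻¹ : ℝ) : ℂ) • y) (by
          rw [hNsmul, Complex.norm_real, Real.norm_of_nonneg (by positivity),
            inv_mul_cancel₀ h0.ne'])
        rw [hUsmul, pairingOp_smul_right, norm_smul, Complex.norm_real,
          Real.norm_of_nonneg (by positivity), inv_mul_le_iff₀ h0] at h1
        rwa [sq]
    refine le_antisymm ?_ (Real.sqrt_le_left (hN0 x) |>.2 (hle x))
    rw [← ENNReal.ofReal_le_ofReal_iff (Real.sqrt_nonneg _), ← hmn, ← h n x, hdual]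
    refine iSup_le fun m => iSup_le fun y => iSup_le fun hy => ENNReal.ofReal_le_ofReal ?_
    have hy1 : N y ≤ 1 := by simpa using hy
    refine (norm_pairingOp_le _ _).trans (mul_le_of_le_one_right (Real.sqrt_nonneg _) ?_)
    exact Real.sqrt_le_one.2 ((hle y).trans (pow_le_one₀ (hN0 y) hy1))
  · intro h n x
    have hx : N x = √‖pairingOp (x.map U) (x.map U)‖ := h n x
    have hx2 : ‖pairingOp (x.map U) (x.map U)‖ = N x ^ 2 := by
      rw [hx, Real.sq_sqrt (norm_nonneg _)]
    rw [hdual, hmn]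
    refine le_antisymm (iSup_le fun m => iSup_le fun y => iSup_le fun hy =>
      ENNReal.ofReal_le_ofReal ?_) ?_
    · have hy1 : √‖pairingOp (y.map U) (y.map U)‖ ≤ 1 := (h m y).symm.trans_le (by simpa using hy)
      rw [hx]
      exact (norm_pairingOp_le _ _).trans (mul_le_of_le_one_right (Real.sqrt_nonneg _) hy1)
    · rcases (hN0 x).eq_or_lt with h0 | h0
      · simp [← h0]
      · -- the supremum is attained at `x / N x`
        refine le_iSup_of_le n (le_iSup_of_le ((((N x)⁻¹ : ℝ) : ℂ) • x) (le_iSup_of_le ?_ ?_))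
        · rw [hNsmul, Complex.norm_real, Real.norm_of_nonneg (by positivity),
            inv_mul_cancel₀ h0.ne', ENNReal.ofReal_one]
        · refine ENNReal.ofReal_le_ofReal (le_of_eq ?_)
          rw [hUsmul, pairingOp_smul_right, norm_smul, Complex.norm_real,
            Real.norm_of_nonneg (by positivity), hx2]
          field_simp

theorem norm_matrixOp_smul {H : Type*} [NormedAddCommGroup H] [InnerProductSpace ℂ H] {n : ℕ}
    (c : ℂ) (x : Matrix (Fin n) (Fin n) (H →L[ℂ] H)) :
    ‖matrixOp (c • x)‖ = ‖c‖ * ‖matrixOp x‖ := by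
  rw [matrixOp_smul]
  exact norm_smul c (matrixOp x)

theorem mnorm_submodule {H : Type*} [NormedAddCommGroup H] [InnerProductSpace ℂ H]
    {E : Submodule ℂ (H →L[ℂ] H)} {n : ℕ} (x : Matrix (Fin n) (Fin n) E) :
    mnorm x = ENNReal.ofReal ‖matrixOp (x.map fun e => (e : H →L[ℂ] H))‖ :=
  (ofReal_norm _).symm

/-- The property defining `OH` in terms of the norms of matrices over `E` alone, for any choice of
the isometry `U` from `E` to `ℓ₂(I)`. -/
theorem isOH_iff {I H : Type*} [NormedAddCommGroup H]
    [InnerProductSpace ℂ H] {E : Submodule ℂ (H →L[ℂ] H)} (U : E ≃ₗᵢ[ℂ] Ell2 I) :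
    IsOH I E ↔ ∀ (n : ℕ) (x : Matrix (Fin n) (Fin n) E),
      ‖matrixOp (x.map fun e => (e : H →L[ℂ] H))‖ = √‖pairingOp (x.map U) (x.map U)‖ := by
  have key : ∀ V : E ≃ₗᵢ[ℂ] Ell2 I, IsCompleteIsometry (toAntidual V) ↔
      ∀ (n : ℕ) (x : Matrix (Fin n) (Fin n) E),
        ‖matrixOp (x.map fun e => (e : H →L[ℂ] H))‖ = √‖pairingOp (x.map V) (x.map V)‖ := by
    intro V
    have hsmul : ∀ {n : ℕ} (c : ℂ) (x : Matrix (Fin n) (Fin n) E),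
        ‖matrixOp ((c • x).map fun e => (e : H →L[ℂ] H))‖ =
          ‖c‖ * ‖matrixOp (x.map fun e => (e : H →L[ℂ] H))‖ := by
      intro n c x
      rw [← norm_matrixOp_smul]
      rfl
    exact @isCompleteIsometry_toAntidual_iff I E _ _ _
      (fun {n} (x : Matrix (Fin n) (Fin n) E) => ‖matrixOp (x.map fun e => (e : H →L[ℂ] H))‖)
      (fun x => ContinuousLinearMap.opNorm_nonneg _) hsmul mnorm_submodule V
  constructor
  · rintro ⟨V, hV⟩ n x
    rw [(key V).1 hV n x]
    have hinner : ∀ a b : E, ⟪V a, V b⟫_ℂ = ⟪U a, U b⟫_ℂ := fun a b => by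
      simpa using (U.symm.trans V).inner_map_map (U a) (U b)
    simp only [pairingOp, Matrix.map_apply, hinner]
  · exact fun h => ⟨U, (key U).2 h⟩

/-- The linear isometries between two such spaces are complete isometries. -/
theorem IsOH.exists_isCompleteIsometry {I H₁ H₂ : Type*} [NormedAddCommGroup H₁]
    [InnerProductSpace ℂ H₁] [NormedAddCommGroup H₂] [InnerProductSpace ℂ H₂]
    {E₁ : Submodule ℂ (H₁ →L[ℂ] H₁)} {E₂ : Submodule ℂ (H₂ →L[ℂ] H₂)} (h₁ : IsOH I E₁)
    (h₂ : IsOH I E₂) : ∃ u : E₁ ≃ₗ[ℂ] E₂, IsCompleteIsometry u := by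
  obtain ⟨U₁, -⟩ := id h₁
  obtain ⟨U₂, -⟩ := id h₂
  refine ⟨(U₁.trans U₂.symm).toLinearEquiv, fun n x => ?_⟩
  have hx : (x.map (U₁.trans U₂.symm).toLinearEquiv).map U₂ = x.map U₁ := by
    ext1 i j
    exact U₂.apply_symm_apply _
  have hn := (isOH_iff U₂).1 h₂ n (x.map (U₁.trans U₂.symm).toLinearEquiv)
  rw [hx, ← (isOH_iff U₁).1 h₁ n x] at hn
  change ‖matrixOp _‖ₑ = ‖matrixOp _‖ₑ
  rw [← ofReal_norm, ← ofReal_norm, hn]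

/-! ### Block diagonal operators -/

theorem hasSum_norm_sq_ell2 {ι : Type*} {G : ι → Type*} [∀ b, NormedAddCommGroup (G b)]
    (f : lp G 2) : HasSum (fun b => ‖f b‖ ^ 2) (‖f‖ ^ 2) := by
  have h := lp.hasSum_norm (p := 2) (by norm_num) f
  simpa using h

section DiagOp

variable {ι : Type*} {G : ι → Type*} [∀ b, NormedAddCommGroup (G b)]
  [∀ b, InnerProductSpace ℂ (G b)]

/-- The block diagonal operator on a Hilbert direct sum given by a bounded family of operators. -/
def diagOp (A : ∀ b, G b →L[ℂ] G b) {C : ℝ} (hC : ∀ b, ‖A b‖ ≤ C) :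
    lp G 2 →L[ℂ] lp G 2 :=
  have hbd : ∀ (f : lp G 2) (b : ι), ‖A b (f b)‖ ^ 2 ≤ C ^ 2 * ‖f b‖ ^ 2 := fun f b => by
    rw [← mul_pow]
    gcongr
    exact (A b).le_of_opNorm_le (hC b) _
  have hsum : ∀ f : lp G 2, Summable fun b => ‖A b (f b)‖ ^ 2 := fun f =>
    Summable.of_nonneg_of_le (fun _ => sq_nonneg _) (hbd f)
      ((hasSum_norm_sq_ell2 f).summable.mul_left _)
  LinearMap.mkContinuous
    { toFun := fun f => ⟨fun b => A b (f b), memℓp_gen (by simpa using hsum f)⟩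
      map_add' := fun f g => by
        ext b
        exact (A b).map_add _ _
      map_smul' := fun c f => by
        ext b
        exact (A b).map_smul c _ }
    |C| fun f => by
      refine abs_le_of_sq_le_sq' ?_ (by positivity) |>.2
      rw [mul_pow, sq_abs, ← (hasSum_norm_sq_ell2 _).tsum_eq, ← (hasSum_norm_sq_ell2 f).tsum_eq,
        ← tsum_mul_left]
      exact (hsum f).tsum_le_tsum (hbd f) ((hasSum_norm_sq_ell2 f).summable.mul_left _)

@[simp]
theorem diagOp_apply (A : ∀ b, G b →L[ℂ] G b) {C : ℝ} (hC : ∀ b, ‖A b‖ ≤ C) (f : lp G 2) (b : ι) :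
    diagOp A hC f b = A b (f b) := rfl

/-- A matrix `X` of block diagonal operators, with matrices of blocks `A.map (· b)`, acts on `Hⁿ`
as the direct sum of these matrices. -/
theorem norm_matrixOp_diag_le {n : ℕ} (A : Matrix (Fin n) (Fin n) (∀ b, G b →L[ℂ] G b))
    (X : Matrix (Fin n) (Fin n) (lp G 2 →L[ℂ] lp G 2))
    (hX : ∀ i j f b, X i j f b = A i j b (f b))
    {c : ℝ} (hc : 0 ≤ c)
    (h : ∀ b, ‖matrixOp (A.map fun a => a b)‖ ≤ c) : ‖matrixOp X‖ ≤ c := by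
  refine ContinuousLinearMap.opNorm_le_bound _ hc fun ξ => ?_
  refine abs_le_of_sq_le_sq' ?_ (by positivity) |>.2
  have hs : ∀ η : PiLp 2 (fun _ : Fin n => lp G 2),
      HasSum (fun b => ∑ i, ‖η i b‖ ^ 2) (‖η‖ ^ 2) := by
    intro η
    rw [PiLp.norm_sq_eq_of_L2]
    exact hasSum_sum fun i _ => hasSum_norm_sq_ell2 (η i)
  rw [mul_pow]
  refine hasSum_le (fun b => ?_) (hs _) ((hs ξ).mul_left (c ^ 2))
  have h1 := (matrixOp (A.map fun a => a b)).le_of_opNorm_le (h b)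
    (WithLp.toLp 2 fun i => ξ i b)
  have h2 := pow_le_pow_left₀ (norm_nonneg _) h1 2
  rw [mul_pow, PiLp.norm_sq_eq_of_L2, PiLp.norm_sq_eq_of_L2] at h2
  refine le_trans (le_of_eq (Finset.sum_congr rfl fun i _ => ?_)) h2
  rw [matrixOp_apply, matrixOp_apply, lp.coeFn_sum, Finset.sum_apply]
  simp only [hX, Matrix.map_apply]

theorem norm_matrixOp_block_le {n : ℕ} (A : Matrix (Fin n) (Fin n) (∀ b, G b →L[ℂ] G b))
    (X : Matrix (Fin n) (Fin n) (lp G 2 →L[ℂ] lp G 2))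
    (hX : ∀ i j f b, X i j f b = A i j b (f b))
    (b : ι) : ‖matrixOp (A.map fun a => a b)‖ ≤ ‖matrixOp X‖ := by
  classical
  refine ContinuousLinearMap.opNorm_le_bound _ (ContinuousLinearMap.opNorm_nonneg _) fun ξ => ?_
  let η : PiLp 2 (fun _ : Fin n => lp G 2) := WithLp.toLp 2 fun i => lp.single 2 b (ξ i)
  have h1 : ‖η‖ = ‖ξ‖ := by
    rw [PiLp.norm_eq_of_L2, PiLp.norm_eq_of_L2]
    simp only [η, lp.norm_single (p := 2) (by norm_num)]
  have h2 : ‖matrixOp (A.map fun a => a b) ξ‖ ≤ ‖matrixOp X η‖ := by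
    refine abs_le_of_sq_le_sq' ?_ (by positivity) |>.2
    rw [PiLp.norm_sq_eq_of_L2, PiLp.norm_sq_eq_of_L2]
    refine Finset.sum_le_sum fun i _ => ?_
    gcongr
    refine le_trans (le_of_eq ?_) (lp.norm_apply_le_norm (p := 2) (by norm_num) _ b)
    rw [matrixOp_apply, matrixOp_apply, lp.coeFn_sum, Finset.sum_apply]
    simp only [hX, Matrix.map_apply, η, lp.single_apply_self]
  rw [← h1]
  exact h2.trans ((matrixOp X).le_opNorm η)

end DiagOp

/-! ### Existence -/

theorem norm_matrixOp_one {H : Type*} [NormedAddCommGroup H] [InnerProductSpace ℂ H]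
    (x : Matrix (Fin 1) (Fin 1) (H →L[ℂ] H)) : ‖matrixOp x‖ = ‖x 0 0‖ := by
  have hn : ∀ ξ : PiLp 2 (fun _ : Fin 1 => H), ‖ξ‖ = ‖ξ 0‖ := fun ξ => by
    rw [PiLp.norm_eq_of_L2]
    simp
  apply le_antisymm
  · refine ContinuousLinearMap.opNorm_le_bound _ (norm_nonneg _) fun ξ => ?_
    rw [hn, hn ξ, matrixOp_apply]
    simpa using (x 0 0).le_opNorm (ξ 0)
  · refine ContinuousLinearMap.opNorm_le_bound _ (norm_nonneg _) fun v => ?_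
    have h := (matrixOp x).le_opNorm (WithLp.toLp 2 fun _ => v)
    rw [hn, hn (WithLp.toLp 2 fun _ => v), matrixOp_apply] at h
    simpa using h

section

variable {K : Type*} [NormedAddCommGroup K] [InnerProductSpace ℂ K]

theorem norm_pairingOp_one {m : ℕ} (x : Matrix (Fin 1) (Fin 1) K) (y : Matrix (Fin m) (Fin m) K) :
    ‖pairingOp y x‖ =
      ‖Matrix.toEuclideanCLM (𝕜 := ℂ) (Matrix.of fun k l => ⟪y k l, x 0 0⟫_ℂ)‖ := by
  rw [pairingOp, norm_matrixOp_one]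
  rfl

theorem norm_pairingOp_one_self (x : Matrix (Fin 1) (Fin 1) K) :
    ‖pairingOp x x‖ = ‖x 0 0‖ ^ 2 := by
  have h : (Matrix.of fun k l : Fin 1 => ⟪x k l, x 0 0⟫_ℂ) = ⟪x 0 0, x 0 0⟫_ℂ • 1 := by
    ext i j
    fin_cases i
    fin_cases j
    simp
  rw [norm_pairingOp_one, h, map_smul, map_one, norm_smul, norm_one, mul_one,
    inner_self_eq_norm_sq_to_K]
  simp

variable (K) in
/-- The index set of the direct sum in the construction of `OH`: the square matrices `y` over `K`
with `‖[⟨y i j, y k l⟩]‖ ≤ 1`, of all sizes. -/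
abbrev UnitMatrix : Type _ := Σ m : ℕ, {y : Matrix (Fin m) (Fin m) K // ‖pairingOp y y‖ ≤ 1}

/-- The block at `y` of the operator assigned to `z`: the matrix `[⟨y k l, z⟩]`. -/
def unitBlock (z : K) (b : UnitMatrix K) :
    EuclideanSpace ℂ (Fin b.1) →L[ℂ] EuclideanSpace ℂ (Fin b.1) :=
  Matrix.toEuclideanCLM (𝕜 := ℂ) (Matrix.of fun k l => ⟪b.2.1 k l, z⟫_ℂ)

theorem norm_pairingOp_unitMatrix_le {n : ℕ} (b : UnitMatrix K) (x : Matrix (Fin n) (Fin n) K) :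
    ‖pairingOp b.2.1 x‖ ≤ √‖pairingOp x x‖ :=
  (norm_pairingOp_le _ _).trans
    (mul_le_of_le_one_left (Real.sqrt_nonneg _) (Real.sqrt_le_one.2 b.2.2))

/-- Haagerup's inequality for the matrix `[z]` of size one. -/
theorem norm_unitBlock_le (z : K) (b : UnitMatrix K) : ‖unitBlock z b‖ ≤ ‖z‖ := by
  have h := norm_pairingOp_unitMatrix_le b (Matrix.of fun _ _ : Fin 1 => z)
  rw [norm_pairingOp_one, norm_pairingOp_one_self, Real.sqrt_sq (norm_nonneg _)] at h
  exact h

variable (K) in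
/-- The Hilbert space of the direct sum. -/
abbrev UnitSum : Type _ := lp (fun b : UnitMatrix K => EuclideanSpace ℂ (Fin b.1)) 2

variable (K) in
/-- The map from `K` to `B(H)` whose range is `OH`. -/
def ohMap : K →ₗ[ℂ] (UnitSum K →L[ℂ] UnitSum K) where
  toFun z := diagOp (unitBlock z) (norm_unitBlock_le z)
  map_add' z w := by
    ext f b i
    simp [unitBlock, Matrix.mulVec, dotProduct, add_mul, Finset.sum_add_distrib]
  map_smul' c z := by
    ext f b i
    simp [unitBlock, Matrix.mulVec, dotProduct, mul_assoc, Finset.mul_sum]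

theorem norm_matrixOp_ohMap {n : ℕ} (x : Matrix (Fin n) (Fin n) K) :
    ‖matrixOp (x.map (ohMap K))‖ = √‖pairingOp x x‖ := by
  have hX : ∀ i j (f : UnitSum K) b, x.map (ohMap K) i j f b = x.map unitBlock i j b (f b) :=
    fun i j f b => rfl
  have hb : ∀ b : UnitMatrix K, matrixOp ((x.map unitBlock).map fun a => a b) =
      pairingOp b.2.1 x := fun b => rfl
  apply le_antisymm
  · refine norm_matrixOp_diag_le _ _ hX (Real.sqrt_nonneg _) fun b => ?_
    rw [hb]
    exact norm_pairingOp_unitMatrix_le b x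
  · rcases (norm_nonneg (pairingOp x x)).eq_or_lt with h0 | h0
    · rw [← h0, Real.sqrt_zero]
      exact norm_nonneg _
    · set g := √‖pairingOp x x‖ with hg
      have hg0 : 0 < g := Real.sqrt_pos.2 h0
      have hg2 : ‖pairingOp x x‖ = g * g := (Real.mul_self_sqrt h0.le).symm
      have hn : ‖((g⁻¹ : ℝ) : ℂ)‖ = g⁻¹ := by
        rw [Complex.norm_real, Real.norm_of_nonneg (by positivity)]
      -- the supremum over the blocks is attained at the multiple of `x` of norm one
      let b : UnitMatrix K := ⟨n, ((g⁻¹ : ℝ) : ℂ) • x, by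
        rw [pairingOp_smul_left, pairingOp_smul_right, norm_smul, norm_smul, RCLike.norm_conj, hn,
          hg2]
        field_simp
        rfl⟩
      refine le_trans (le_of_eq ?_) (norm_matrixOp_block_le _ _ hX b)
      rw [hb, pairingOp_smul_left, norm_smul, RCLike.norm_conj, hn, hg2]
      field_simp

variable (K) in
/-- `ohMap` as a linear isometry; matrices of size one show that it is isometric. -/
def ohIsometry : K →ₗᵢ[ℂ] (UnitSum K →L[ℂ] UnitSum K) where
  __ := ohMap K
  norm_map' z := by
    have h := norm_matrixOp_ohMap (Matrix.of fun _ _ : Fin 1 => z)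
    rw [norm_matrixOp_one, norm_pairingOp_one_self, Real.sqrt_sq (norm_nonneg _)] at h
    exact h

end

theorem isOH_range_ohIsometry (I : Type*) :
    IsOH I (LinearMap.range (ohIsometry (Ell2 I)).toLinearMap) := by
  let U := (ohIsometry (Ell2 I)).equivRange.symm
  refine (isOH_iff U).2 fun n x => ?_
  rw [← norm_matrixOp_ohMap]
  congr 2
  ext1 i j
  exact (congrArg Subtype.val (U.symm_apply_apply (x i j))).symm

/-! ### Finite compressions of operators on a Hilbertian tensor product -/

section Compression

variable {V : Type*} [NormedAddCommGroup V] [InnerProductSpace ℂ V]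

/-- The operator `M = J* X J` is given by its matrix coefficients. -/
theorem norm_compression_le {D : Type*} [NormedAddCommGroup D] [InnerProductSpace ℂ D]
    (J : D →ₗᵢ[ℂ] V) (X : V →L[ℂ] V) (M : D →L[ℂ] D)
    (hM : ∀ u v, ⟪J u, X (J v)⟫_ℂ = ⟪u, M v⟫_ℂ) : ‖M‖ ≤ ‖X‖ := by
  refine opNorm_le_of_norm_inner_le M (norm_nonneg _) fun u v => ?_
  rw [← hM, ← J.norm_map u, ← J.norm_map v]
  exact norm_inner_apply_le X _ _

/-- The norm of `X` is at most the supremum of the norms of its compressions along isometries `J n`,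
if every vector of a set with dense span is eventually in the range of `J n`. -/
theorem opNorm_le_of_compression_le {D : ℕ → Type*} [∀ n, NormedAddCommGroup (D n)]
    [∀ n, InnerProductSpace ℂ (D n)] (J : ∀ n, D n →ₗᵢ[ℂ] V) {S : Set V}
    (hS : Dense (Submodule.span ℂ S : Set V))
    (hJ : ∀ z ∈ S, ∀ᶠ n in Filter.atTop, z ∈ LinearMap.range (J n).toLinearMap)
    (X : V →L[ℂ] V) (M : ∀ n, D n →L[ℂ] D n)
    (hM : ∀ n u v, ⟪J n u, X (J n v)⟫_ℂ = ⟪u, M n v⟫_ℂ) {C : ℝ} (hC : 0 ≤ C)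
    (h : ∀ n, ‖M n‖ ≤ C) : ‖X‖ ≤ C := by
  have hspan : ∀ z ∈ Submodule.span ℂ S,
      ∀ᶠ n in Filter.atTop, z ∈ LinearMap.range (J n).toLinearMap := by
    intro z hz
    induction hz using Submodule.span_induction with
    | mem z hz => exact hJ z hz
    | zero => exact Filter.Eventually.of_forall fun n => Submodule.zero_mem _
    | add y z _ _ hy hz => filter_upwards [hy, hz] with n h1 h2 using Submodule.add_mem _ h1 h2
    | smul c z _ hz => filter_upwards [hz] with n h1 using Submodule.smul_mem _ c h1
  refine opNorm_le_of_norm_inner_le_of_dense hS X hC fun y hy z hz => ?_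
  obtain ⟨n, ⟨u, rfl⟩, v, rfl⟩ := ((hspan y hy).and (hspan z hz)).exists
  change ‖⟪J n u, X (J n v)⟫_ℂ‖ ≤ C * ‖J n u‖ * ‖J n v‖
  rw [hM, (J n).norm_map, (J n).norm_map]
  refine (norm_inner_apply_le _ _ _).trans ?_
  gcongr
  exact h n

end Compression

section Tensor

variable {H L : Type*} [NormedAddCommGroup H] [InnerProductSpace ℂ H] [NormedAddCommGroup L]
  [InnerProductSpace ℂ L]

/-- The elementary tensor `x ⊗ y` in the Hilbertian tensor product. -/
def hilbertTmul (x : H) (y : L) : HilbertTensor H L := ((x ⊗ₜ[ℂ] y : H ⊗[ℂ] L) : HilbertTensor H L)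

theorem inner_hilbertTmul (x x' : H) (y y' : L) :
    ⟪hilbertTmul x y, hilbertTmul x' y'⟫_ℂ = ⟪x, x'⟫_ℂ * ⟪y, y'⟫_ℂ := by
  rw [hilbertTmul, hilbertTmul, UniformSpace.Completion.inner_coe, TensorProduct.inner_tmul]

theorem tensorOp_hilbertTmul (a : H →L[ℂ] H) (b : L →L[ℂ] L) (x : H) (y : L) :
    tensorOp a b (hilbertTmul x y) = hilbertTmul (a x) (b y) :=
  tensorOp_tmul a b x y

/-- The elementary tensor as a bilinear map. -/
def hilbertTmulₗ : H →ₗ[ℂ] L →ₗ[ℂ] HilbertTensor H L :=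
  LinearMap.mk₂ ℂ hilbertTmul
    (fun x x' y => by
      simp only [hilbertTmul, TensorProduct.add_tmul, UniformSpace.Completion.coe_add])
    (fun c x y => by
      simp only [hilbertTmul, ← TensorProduct.smul_tmul', UniformSpace.Completion.coe_smul])
    (fun x y y' => by
      simp only [hilbertTmul, TensorProduct.tmul_add, UniformSpace.Completion.coe_add])
    (fun c x y => by
      simp only [hilbertTmul, TensorProduct.tmul_smul, UniformSpace.Completion.coe_smul])

theorem norm_hilbertTmulₗ (x : H) (y : L) : ‖hilbertTmulₗ x y‖ = ‖x‖ * ‖y‖ := by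
  change ‖hilbertTmul x y‖ = _
  rw [hilbertTmul, UniformSpace.Completion.norm_coe, TensorProduct.norm_tmul]

theorem dense_span_hilbertTmul {A : Set H} {B : Set L}
    (hA : Dense (Submodule.span ℂ A : Set H)) (hB : Dense (Submodule.span ℂ B : Set L)) :
    Dense (Submodule.span ℂ (Set.image2 hilbertTmul A B) : Set (HilbertTensor H L)) := by
  set S := (Submodule.span ℂ (Set.image2 (hilbertTmul (H := H) (L := L)) A B)).topologicalClosure
    with hS
  have hScl : IsClosed (S : Set (HilbertTensor H L)) := Submodule.isClosed_topologicalClosure _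
  have h1 : ∀ x, ∀ y ∈ B, hilbertTmul x y ∈ S := by
    intro x y hy
    have hcont : Continuous fun x : H => hilbertTmulₗ x y :=
      AddMonoidHomClass.continuous_of_bound (hilbertTmulₗ.flip y) ‖y‖ fun x => by
        rw [LinearMap.flip_apply, norm_hilbertTmulₗ, mul_comm]
    have hsub : Submodule.span ℂ A ≤ S.comap (hilbertTmulₗ.flip y) :=
      Submodule.span_le.2 fun a ha => Submodule.le_topologicalClosure _
        (Submodule.subset_span (Set.mem_image2_of_mem ha hy))
    exact closure_minimal hsub (hScl.preimage hcont) (hA x)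
  have h2 : ∀ x y, hilbertTmul x y ∈ S := by
    intro x y
    have hcont : Continuous fun y : L => hilbertTmulₗ x y :=
      AddMonoidHomClass.continuous_of_bound (hilbertTmulₗ x) ‖x‖ fun y => by
        rw [norm_hilbertTmulₗ]
    have hsub : Submodule.span ℂ B ≤ S.comap (hilbertTmulₗ x) :=
      Submodule.span_le.2 fun b hb => h1 x b hb
    exact closure_minimal hsub (hScl.preimage hcont) (hB y)
  have h3 : ∀ t : H ⊗[ℂ] L, (t : HilbertTensor H L) ∈ S := by
    intro t
    induction t using TensorProduct.induction_on with
    | zero =>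
      rw [UniformSpace.Completion.coe_zero]
      exact S.zero_mem
    | tmul x y => exact h2 x y
    | add s t hs ht =>
      rw [UniformSpace.Completion.coe_add]
      exact S.add_mem hs ht
  intro z
  exact closure_minimal (Set.range_subset_iff.2 h3) hScl (UniformSpace.Completion.denseRange_coe z)

/-- The isometry `(ξ k) ↦ ∑ ξ k ⊗ e k` from `Hⁿ` to `H ⊗ L`, for an orthonormal sequence `e`. -/
def columnIsometry {e : ℕ → L} (he : Orthonormal ℂ e) (n : ℕ) :
    PiLp 2 (fun _ : Fin n => H) →ₗᵢ[ℂ] HilbertTensor H L :=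
  LinearMap.isometryOfInner
    { toFun := fun ξ => ∑ k : Fin n, hilbertTmulₗ (ξ k) (e k)
      map_add' := fun ξ η => by simp [Finset.sum_add_distrib]
      map_smul' := fun c ξ => by simp [Finset.smul_sum] }
    fun ξ η => by
      change ⟪∑ k : Fin n, hilbertTmul (ξ k) (e k), ∑ k : Fin n, hilbertTmul (η k) (e k)⟫_ℂ = _
      rw [PiLp.inner_apply, sum_inner]
      refine Finset.sum_congr rfl fun k _ => ?_
      rw [inner_sum, Finset.sum_eq_single k]
      · rw [inner_hilbertTmul, inner_self_eq_norm_sq_to_K, he.1]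
        simp
      · intro l _ hl
        rw [inner_hilbertTmul, he.2 fun h => hl (Fin.ext h.symm), mul_zero]
      · simp

theorem columnIsometry_apply {e : ℕ → L} (he : Orthonormal ℂ e) (n : ℕ)
    (ξ : PiLp 2 (fun _ : Fin n => H)) :
    columnIsometry he n ξ = ∑ k : Fin n, hilbertTmul (ξ k) (e k) := rfl

theorem eventually_mem_range_columnIsometry {e : ℕ → L} (he : Orthonormal ℂ e) :
    ∀ z ∈ Set.image2 hilbertTmul (Set.univ : Set H) (Set.range e), ∀ᶠ n in Filter.atTop,
      z ∈ LinearMap.range (columnIsometry (H := H) he n).toLinearMap := by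
  rintro _ ⟨x, -, _, ⟨k, rfl⟩, rfl⟩
  filter_upwards [Filter.eventually_gt_atTop k] with n hn
  refine ⟨WithLp.toLp 2 (Pi.single ⟨k, hn⟩ x), ?_⟩
  change ∑ l : Fin n, hilbertTmulₗ ((Pi.single (M := fun _ => H) ⟨k, hn⟩ x : Fin n → H) l) (e l) = _
  rw [Finset.sum_eq_single ⟨k, hn⟩]
  · rw [Pi.single_eq_same]
    rfl
  · intro l _ hl
    rw [Pi.single_eq_of_ne hl, map_zero, LinearMap.zero_apply]
  · simp

/-- The compression of `∑ T p ⊗ a p` is a matrix over the span of the operators `T p`. -/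
theorem inner_columnIsometry_sum_tensorOp {I : Type*} {e : ℕ → L} (he : Orthonormal ℂ e) (n : ℕ)
    (s : Finset I) (T : I → H →L[ℂ] H) (a : I → L →L[ℂ] L)
    (ξ η : PiLp 2 (fun _ : Fin n => H)) :
    ⟪columnIsometry he n ξ, (∑ p ∈ s, tensorOp (T p) (a p)) (columnIsometry he n η)⟫_ℂ =
      ⟪ξ, matrixOp (Matrix.of fun k l : Fin n => ∑ p ∈ s, ⟪e k, a p (e l)⟫_ℂ • T p) η⟫_ℂ := by
  simp only [columnIsometry_apply, PiLp.inner_apply, matrixOp_apply, map_sum, sum_inner, inner_sum,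
    sum_apply, tensorOp_hilbertTmul, inner_hilbertTmul, Matrix.of_apply,
    smul_apply, inner_smul_right]
  rw [Finset.sum_comm (s := (Finset.univ : Finset (Fin n))) (t := (Finset.univ : Finset (Fin n)))]
  refine Finset.sum_congr rfl fun l _ => ?_
  rw [Finset.sum_comm]
  refine Finset.sum_congr rfl fun k _ => Finset.sum_congr rfl fun p _ => mul_comm _ _

/-- The isometry `(u k i) ↦ ∑ u k i • (e k ⊗ f i)` from `(ℂⁿ)ⁿ` to `H ⊗ L`, for orthonormal
sequences `e` and `f`. -/
def squareIsometry {e : ℕ → H} {f : ℕ → L} (he : Orthonormal ℂ e) (hf : Orthonormal ℂ f) (n : ℕ) :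
    PiLp 2 (fun _ : Fin n => EuclideanSpace ℂ (Fin n)) →ₗᵢ[ℂ] HilbertTensor H L :=
  LinearMap.isometryOfInner
    { toFun := fun u => ∑ k : Fin n, ∑ i : Fin n, u k i • hilbertTmul (e k) (f i)
      map_add' := fun u v => by simp [Finset.sum_add_distrib, add_smul]
      map_smul' := fun c u => by simp [Finset.smul_sum, mul_smul] }
    fun u v => by
      have ho : Orthonormal ℂ fun q : Fin n × Fin n => hilbertTmul (e q.1) (f q.2) := by
        classical
        rw [orthonormal_iff_ite] at he hf ⊢
        rintro ⟨k, i⟩ ⟨l, j⟩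
        rw [inner_hilbertTmul, he, hf]
        by_cases h1 : k = l <;> by_cases h2 : i = j <;> simp [h1, h2, Fin.val_inj]
      change ⟪∑ k : Fin n, ∑ i : Fin n, u k i • hilbertTmul (e k) (f i),
        ∑ k : Fin n, ∑ i : Fin n, v k i • hilbertTmul (e k) (f i)⟫_ℂ = _
      rw [← Fintype.sum_prod_type' (f := fun k i : Fin n => u k i • hilbertTmul (e k) (f i)),
        ← Fintype.sum_prod_type' (f := fun k i : Fin n => v k i • hilbertTmul (e k) (f i)),
        ho.inner_sum (fun q => u q.1 q.2) (fun q => v q.1 q.2), Fintype.sum_prod_type]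
      simp only [PiLp.inner_apply, RCLike.inner_apply]
      exact Finset.sum_congr rfl fun k _ => Finset.sum_congr rfl fun i _ => mul_comm _ _

theorem squareIsometry_apply {e : ℕ → H} {f : ℕ → L} (he : Orthonormal ℂ e)
    (hf : Orthonormal ℂ f) (n : ℕ) (u : PiLp 2 (fun _ : Fin n => EuclideanSpace ℂ (Fin n))) :
    squareIsometry he hf n u = ∑ k : Fin n, ∑ i : Fin n, u k i • hilbertTmul (e k) (f i) := rfl

theorem eventually_mem_range_squareIsometry {e : ℕ → H} {f : ℕ → L} (he : Orthonormal ℂ e)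
    (hf : Orthonormal ℂ f) :
    ∀ z ∈ Set.image2 hilbertTmul (Set.range e) (Set.range f), ∀ᶠ n in Filter.atTop,
      z ∈ LinearMap.range (squareIsometry he hf n).toLinearMap := by
  rintro _ ⟨_, ⟨k, rfl⟩, _, ⟨i, rfl⟩, rfl⟩
  filter_upwards [Filter.eventually_gt_atTop k, Filter.eventually_gt_atTop i] with n hk hi
  refine ⟨WithLp.toLp 2 (Pi.single ⟨k, hk⟩ (EuclideanSpace.single ⟨i, hi⟩ 1)), ?_⟩
  change squareIsometry he hf n _ = _
  rw [squareIsometry_apply, Finset.sum_eq_single ⟨k, hk⟩, Finset.sum_eq_single ⟨i, hi⟩]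
  · simp
  · intro l _ hl
    simp [hl]
  · simp
  · intro l _ hl
    simp [hl]
  · simp

end Tensor

/-! ### The norm of `∑ T i ⊗ a i` -/

theorem ConjSpace.orthonormal_mk {L ι : Type*} [NormedAddCommGroup L] [InnerProductSpace ℂ L]
    {e : ι → L} (he : Orthonormal ℂ e) : Orthonormal ℂ fun i => ConjSpace.mk (e i) :=
  ⟨he.1, fun _ _ hij => (ConjSpace.inner_mk _ _).trans (he.2 hij.symm)⟩

theorem ConjSpace.dense_span_range_mk {L ι : Type*} [NormedAddCommGroup L] [InnerProductSpace ℂ L]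
    {e : ι → L} (he : Dense (Submodule.span ℂ (Set.range e) : Set L)) :
    Dense (Submodule.span ℂ (Set.range fun i => ConjSpace.mk (e i)) : Set (ConjSpace L)) := by
  have hle : ∀ z ∈ Submodule.span ℂ (Set.range e),
      ConjSpace.mk z ∈ Submodule.span ℂ (Set.range fun i => ConjSpace.mk (e i)) := by
    intro z hz
    induction hz using Submodule.span_induction with
    | mem z hz =>
      obtain ⟨i, rfl⟩ := hz
      exact Submodule.subset_span ⟨i, rfl⟩
    | zero => exact Submodule.zero_mem _
    | add y z _ _ hy hz => exact Submodule.add_mem _ hy hz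
    | smul c z _ hz =>
      rw [show ConjSpace.mk (c • z) = conj c • ConjSpace.mk z by simp [ConjSpace.smul_mk]]
      exact Submodule.smul_mem _ _ hz
  have hd : Dense (ConjSpace.mk.symm ⁻¹' (Submodule.span ℂ (Set.range e) : Set L) :
      Set (ConjSpace L)) := he
  exact hd.mono hle

/-- The compression of `∑ a p ⊗ ā p` is the pairing with itself of the matrix over a Hilbert space
obtained from orthonormal vectors `b p` in place of the operators `T p`. -/
theorem inner_squareIsometry_sum_tensorOp {I L K : Type*} [NormedAddCommGroup L]
    [InnerProductSpace ℂ L] [NormedAddCommGroup K] [InnerProductSpace ℂ K] {e : ℕ → L}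
    (he : Orthonormal ℂ e) (n : ℕ) (s : Finset I) (a : I → L →L[ℂ] L)
    {b : I → K} (hb : Orthonormal ℂ b)
    (u v : PiLp 2 (fun _ : Fin n => EuclideanSpace ℂ (Fin n))) :
    ⟪squareIsometry he (ConjSpace.orthonormal_mk he) n u, (∑ p ∈ s, tensorOp (a p) (conjOp (a p)))
        (squareIsometry he (ConjSpace.orthonormal_mk he) n v)⟫_ℂ =
      ⟪u, pairingOp (Matrix.of fun k l : Fin n => ∑ p ∈ s, ⟪e k, a p (e l)⟫_ℂ • b p)
        (Matrix.of fun k l : Fin n => ∑ p ∈ s, ⟪e k, a p (e l)⟫_ℂ • b p) v⟫_ℂ := by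
  have hconj : ∀ p x, conjOp (a p) (ConjSpace.mk x) = ConjSpace.mk (a p x) := fun p x => rfl
  rw [inner_pairingOp]
  simp only [Matrix.of_apply, hb.inner_sum]
  simp only [squareIsometry_apply, map_sum, sum_inner, inner_sum, map_smul,
    sum_apply, tensorOp_hilbertTmul, inner_hilbertTmul,
    inner_smul_right, inner_smul_left, hconj, ConjSpace.inner_mk]
  have hcomm : ∀ F : Fin n → Fin n → Fin n → Fin n → ℂ,
      ∑ l, ∑ j, ∑ k, ∑ i, F l j k i = ∑ k, ∑ i, ∑ l, ∑ j, F l j k i := fun F => by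
    have h := Finset.sum_comm (s := (Finset.univ : Finset (Fin n × Fin n)))
      (t := (Finset.univ : Finset (Fin n × Fin n))) (f := fun q r => F q.1 q.2 r.1 r.2)
    simpa only [Fintype.sum_prod_type] using h
  rw [← hcomm]
  refine Finset.sum_congr rfl fun l _ => Finset.sum_congr rfl fun j _ => ?_
  rw [Finset.sum_comm, Finset.mul_sum]
  refine Finset.sum_congr rfl fun k _ => ?_
  rw [Finset.sum_comm, Finset.mul_sum]
  refine Finset.sum_congr rfl fun i _ => ?_
  rw [Finset.sum_mul, Finset.mul_sum, Finset.mul_sum]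
  refine Finset.sum_congr rfl fun p _ => ?_
  rw [inner_conj_symm]
  ring

/-- With `x n` the matrix `[∑ ⟨e k, a p (e l)⟩ T p]` over `E`, the compressions of the two operators
have norms `‖x n‖` and `‖x n‖²`. -/
theorem IsOH.norm_sum_tensorOp {I H : Type*} [NormedAddCommGroup H] [InnerProductSpace ℂ H]
    {E : Submodule ℂ (H →L[ℂ] H)} (hE : IsOH I E) {T : I → E} (hT : IsHilbertBasis T)
    (s : Finset I) (a : I → Ell2 ℕ →L[ℂ] Ell2 ℕ) :
    ‖∑ i ∈ s, tensorOp (T i : H →L[ℂ] H) (a i)‖ =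
      √‖∑ i ∈ s, tensorOp (a i) (conjOp (a i))‖ := by
  obtain ⟨U, b, hUb⟩ := hT
  let e : HilbertBasis ℕ ℂ (Ell2 ℕ) := HilbertBasis.ofRepr (LinearIsometryEquiv.refl ℂ (Ell2 ℕ))
  have he := e.orthonormal
  have hed : Dense (Submodule.span ℂ (Set.range e) : Set (Ell2 ℕ)) :=
    Submodule.dense_iff_topologicalClosure_eq_top.2 e.dense_span
  let x : ∀ n : ℕ, Matrix (Fin n) (Fin n) E := fun n =>
    Matrix.of fun k l => ∑ p ∈ s, ⟪e k, a p (e l)⟫_ℂ • T p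
  have hxT : ∀ n, (x n).map (fun z => (z : H →L[ℂ] H)) =
      Matrix.of fun k l : Fin n => ∑ p ∈ s, ⟪e k, a p (e l)⟫_ℂ • (T p : H →L[ℂ] H) := by
    intro n
    ext1 k l
    simp [x]
  have hxb : ∀ n, (x n).map U =
      Matrix.of fun k l : Fin n => ∑ p ∈ s, ⟪e k, a p (e l)⟫_ℂ • b p := by
    intro n
    ext1 k l
    simp [x, hUb]
  have hnorm := fun n => (isOH_iff U).1 hE n (x n)
  have hM₁ := fun n => inner_columnIsometry_sum_tensorOp (H := H) he n s (fun p => T p) a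
  have hM₂ := fun n => inner_squareIsometry_sum_tensorOp he n s a b.orthonormal
  simp only [← hxT] at hM₁
  simp only [← hxb] at hM₂
  have hd₁ : Dense (Submodule.span ℂ (Set.image2 hilbertTmul (Set.univ : Set H) (Set.range e)) :
      Set (HilbertTensor H (Ell2 ℕ))) := dense_span_hilbertTmul (by simp) hed
  apply le_antisymm
  · have h := opNorm_le_of_compression_le (columnIsometry (H := H) he) hd₁
      (eventually_mem_range_columnIsometry he) (∑ p ∈ s, tensorOp (T p : H →L[ℂ] H) (a p))
      (fun n => matrixOp ((x n).map fun z => (z : H →L[ℂ] H)))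
    refine h hM₁ (Real.sqrt_nonneg _) fun n => ?_
    rw [hnorm]
    exact Real.sqrt_le_sqrt (norm_compression_le _ _ _ (hM₂ n))
  · rw [Real.sqrt_le_left (ContinuousLinearMap.opNorm_nonneg _)]
    have h := opNorm_le_of_compression_le (squareIsometry he (ConjSpace.orthonormal_mk he))
      (dense_span_hilbertTmul hed (ConjSpace.dense_span_range_mk hed))
      (eventually_mem_range_squareIsometry he _) (∑ p ∈ s, tensorOp (a p) (conjOp (a p)))
      (fun n => pairingOp ((x n).map U) ((x n).map U))
    refine h hM₂ (sq_nonneg _) fun n => ?_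
    rw [← Real.sqrt_le_left (ContinuousLinearMap.opNorm_nonneg _), ← hnorm]
    exact norm_compression_le _ _ _ (hM₁ n)

end

end OperatorSpace

theorem mainTheorem1 (I : Type u) :
    -- existence
    (∃ (H : Type u) (_ : NormedAddCommGroup H) (_ : InnerProductSpace ℂ H) (_ : CompleteSpace H)
        (E : Submodule ℂ (H →L[ℂ] H)), OperatorSpace.IsOH I E) ∧
    -- uniqueness up to complete isometry
    (∀ (H₁ : Type v) [NormedAddCommGroup H₁] [InnerProductSpace ℂ H₁] [CompleteSpace H₁]
        (E₁ : Submodule ℂ (H₁ →L[ℂ] H₁))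
        (H₂ : Type w) [NormedAddCommGroup H₂] [InnerProductSpace ℂ H₂] [CompleteSpace H₂]
        (E₂ : Submodule ℂ (H₂ →L[ℂ] H₂)),
        OperatorSpace.IsOH I E₁ → OperatorSpace.IsOH I E₂ →
        ∃ u : E₁ ≃ₗ[ℂ] E₂, OperatorSpace.IsCompleteIsometry u) ∧
    -- the norm of `∑ Tᵢ ⊗ aᵢ` in `OH(I) ⊗_min B(ℓ₂)`
    (∀ (H : Type v) [NormedAddCommGroup H] [InnerProductSpace ℂ H] [CompleteSpace H]
        (E : Submodule ℂ (H →L[ℂ] H)), OperatorSpace.IsOH I E →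
        ∀ T : I → E, OperatorSpace.IsHilbertBasis T →
        ∀ a : I →₀ (OperatorSpace.Ell2 ℕ →L[ℂ] OperatorSpace.Ell2 ℕ),
          ‖∑ i ∈ a.support, OperatorSpace.tensorOp (T i : H →L[ℂ] H) (a i)‖ =
            √‖∑ i ∈ a.support, OperatorSpace.tensorOp (a i) (OperatorSpace.conjOp (a i))‖) := by
  refine ⟨?_, ?_, ?_⟩
  · exact ⟨_, inferInstance, inferInstance, inferInstance, _,
      OperatorSpace.isOH_range_ohIsometry I⟩
  · intro H₁ _ _ _ E₁ H₂ _ _ _ E₂ h₁ h₂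
    exact h₁.exists_isCompleteIsometry h₂
  · intro H _ _ _ E hE T hT a
    exact hE.norm_sum_tensorOp hT a.support a
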